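/- **Definitions.** Write $[n]=\{1,\dots,n\}$. A (subspace) arrangement $\mathscr A=\{H_1,\dots,H_p\}$ is a finite collection of proper linear subspaces $H_s\subsetneq\mathbb R^n$, each given by finitely many equations with integer coefficients $$L_s^j(\mathbf x)=a^s_{1j}x_1+\cdots+a^s_{nj}x_n=0,\qquad 1\le j\le r_s .$$ Let $\mathrm{supp}(H_s)=\{i\in[n]: a^s_{ij}\ne 0\text{ for some }j\}$. For a finite set $\mathscr B$ of subspaces of a finite-dimensional real vector space $E$, let $L(\mathscr B)$ be the set of all intersections of members of $\mathscr B$, including the empty intersection $E$, ordered by reverse inclusion, let $\mu$ be its Möbius function, and let $$\chi_{\mathscr B}(q)=\sum_{X\in L(\mathscr B)}\mu(E,X)\,q^{\dim X}$$ be the characteristic polynomial. Let $\mathbf m=(m_1,\dots,m_n)\in\mathbb Z_{\ge0}^n$, $\mathrm{supp}(\mathbf m)=\{i: m_i\neq 0\}$, and let $S\subseteq \mathrm{supp}(\mathbf m)$ be the set of special nodes. For a finite field $\mathbb F_q$, an $S$-marked multi-coloring of $\mathscr A$ associated to $\mathbf m$ is a map $i\mapsto C_i$ from $[n]$ to the finite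 multisets on $\mathbb F_q$ such that * $C_i$ is a set (has no repeated element) for all $i\notin S$; * $|C_i|=m_i$ (with multiplicity) for all $i$; * for every $s$ there is no $\mathbf x\in\mathbb F_q^n$ such that $x_j\in C_j$ for all $j\in\mathrm{supp}(H_s)$ and $L_s^1(\mathbf x)=\dots=L_s^{r_s}(\mathbf x)=0$ in $\mathbb F_q$. Let ${}_{\mathbf m}\Pi^{\mathrm{mark}}_{\mathscr A}(q)$ be the number of these multi-colorings. Let $S(\mathbf m)$ be the set of all tuples $\underline\lambda=(\boldsymbol\lambda_i)_{i\in[n]}$ of partitions $\boldsymbol\lambda_i\vdash m_i$ with $\boldsymbol\lambda_i=(1^{m_i})$ for $i\notin S$; let $\ell(\boldsymbol\lambda_i)$ be the number of parts of $\boldsymbol\lambda_i$ and $d_k^{\boldsymbol\lambda_i}$ the number of its parts equal to $k$. For $\underline\lambda\in S(\mathbf m)$ the clan arrangement $\mathscr A(\underline\lambda,\mathbf m)$ is the arrangement in the real vector space with coordinates $x_{ir}$ ($i\in[n]$, $1\le r\le\ell(\boldsymbol\lambda_i)$) consisting of * the hyperplanes $x_{ir}=x_{it}$ for $i\in\mathrm{supp}(\mathbf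 m)$ and $1\le r\ne t\le\ell(\boldsymbol\lambda_i)$; * for every $s$ with $\mathrm{supp}(H_s)\subseteq\mathrm{supp}(\mathbf m)$ and every tuple $\mathbf k=(k_i)_{i\in\mathrm{supp}(\mathbf m)}$ with $1\le k_i\le\ell(\boldsymbol\lambda_i)$, the subspace given by $\sum_{i\in\mathrm{supp}(\mathbf m)}a^s_{ij}x_{ik_i}=0$, $1\le j\le r_s$. **Theorem.** There is an integer $N$ (depending on $\mathscr A$, $\mathbf m$, $S$) such that for every prime $p>N$ and every power $q$ of $p$, $${}_{\mathbf m}\Pi^{\mathrm{mark}}_{\mathscr A}(q)=\sum_{\underline\lambda\in S(\mathbf m)}\frac{\chi_{\mathscr A(\underline\lambda,\mathbf m)}(q)}{\prod_{i\in\mathrm{supp}(\mathbf m)}\prod_{k\ge1}\bigl(d_k^{\boldsymbol\lambda_i}!\bigr)} .$$ In particular, ${}_{\mathbf m}\Pi^{\mathrm{mark}}_{\mathscr A}(q)$ is a polynomial in $q$: there is exactly one polynomial $P\in\mathbb C[x]$ such that, for some $N$, ${}_{\mathbf m}\Pi^{\mathrm{mark}}_{\mathscr A}(q)=P(q)$ for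 all powers $q$ of primes $p>N$; and for every $z\in\mathbb C$, $P(z)$ is the value of the right-hand side above at $q=z$. -/

import Mathlib

universe u

noncomputable section

/-- A subspace arrangement in the coordinate space indexed by `V`, given by integral equations:
a finite family of systems of linear forms, where `L s j v` is the coefficient of the variable
`x_v` in the `j`-th equation of the `s`-th subspace. -/
structure IntArrangement (V : Type) where
  Idx : Type
  finite_idx : Finite Idx
  r : Idx → ℕ
  L : (s : Idx) → Fin (r s) → V → ℤ

namespace IntArrangement

variable {V : Type}

/-- The support of the `s`-th subspace: the variables that occur in its equations. -/
def support (A : IntArrangement V) (s : A.Idx) : Set V :=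
  {v | ∃ j, A.L s j v ≠ 0}

/-- The `s`-th subspace over a field `K`: the common zeros in `K^V` of the linear forms `L s j`,
whose coefficients are mapped to `K`. For `K = ℝ` these are the members of the arrangement,
for `K` a finite field those of its reduction. -/
def subspace [Fintype V] (A : IntArrangement V) (K : Type*) [Field K] (s : A.Idx) :
    Submodule K (V → K) where
  carrier := {x | ∀ j, ∑ v, (A.L s j v : K) * x v = 0}
  zero_mem' := by
    intro j
    simp
  add_mem' := by
    intro x y hx hy j
    have h1 := hx j
    have h2 := hy j
    simp only [Pi.add_apply, mul_add, Finset.sum_add_distrib, h1, h2, add_zero]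
  smul_mem' := by
    intro c x hx j
    have h1 := hx j
    simp only [Pi.smul_apply, smul_eq_mul, mul_left_comm _ c, ← Finset.mul_sum, h1, mul_zero]

/-- The arrangement as a finite set of subspaces of `ℝ^V`. -/
def realSubspaces [Fintype V] (A : IntArrangement V) : Finset (Submodule ℝ (V → ℝ)) :=
  haveI := A.finite_idx
  (Set.finite_range (A.subspace ℝ)).toFinset

end IntArrangement

open Classical in
/-- The intersection poset of a finite set of subspaces: all intersections of its members (the
empty intersection being the whole space), ordered by reverse inclusion. -/
def intersectionPoset {E : Type*} [AddCommGroup E] [Module ℝ E]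
    (𝒜 : Finset (Submodule ℝ E)) : Finset (Submodule ℝ E)ᵒᵈ :=
  𝒜.powerset.image fun T => OrderDual.toDual (T.inf id)

/-- The whole space, as an element of the intersection poset. -/
def wholeSpace {E : Type*} [AddCommGroup E] [Module ℝ E]
    (𝒜 : Finset (Submodule ℝ E)) : intersectionPoset 𝒜 :=
  ⟨OrderDual.toDual ⊤, by
    classical
    exact Finset.mem_image.2 ⟨∅, Finset.empty_mem_powerset _, rfl⟩⟩

open Classical in
/-- The Möbius function `μ(ℝ^n, X)` of the intersection poset. -/
def moebiusFromWhole {E : Type*} [AddCommGroup E] [Module ℝ E]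
    (𝒜 : Finset (Submodule ℝ E)) (X : intersectionPoset 𝒜) : ℤ :=
  letI : LocallyFiniteOrder (intersectionPoset 𝒜) := Fintype.toLocallyFiniteOrder
  IncidenceAlgebra.mu ℤ (wholeSpace 𝒜) X

/-- The characteristic polynomial `∑_X μ(ℝ^n, X) q^(dim X)` of a finite set of subspaces. -/
def charPolyOfSubspaces {E : Type*} [AddCommGroup E] [Module ℝ E]
    (𝒜 : Finset (Submodule ℝ E)) : Polynomial ℤ :=
  ∑ X : intersectionPoset 𝒜,
    Polynomial.C (moebiusFromWhole 𝒜 X) *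
      Polynomial.X ^ Module.finrank ℝ (OrderDual.ofDual X.1 : Submodule ℝ E)

namespace IntArrangement

variable {V : Type}

/-- The characteristic polynomial of an arrangement. -/
def charPoly [Fintype V] (A : IntArrangement V) : Polynomial ℤ :=
  charPolyOfSubspaces A.realSubspaces

/-- `f` is an `S`-marked multi-coloring of `A` associated to `m`, with the elements of the field
`F` as colors. In the third condition, only the colors of the nodes in the support of the subspace
matter; the other coordinates of `x` are unrestricted. -/
structure IsMarkedColoring [Fintype V] (A : IntArrangement V) (m : V → ℕ) (S : Finset V)
    {F : Type*} [Field F] (f : V → Multiset F) : Prop where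
  nodup : ∀ i ∉ S, (f i).Nodup
  card_eq : ∀ i, Multiset.card (f i) = m i
  avoids : ∀ s, ¬ ∃ x : V → F, (∀ j ∈ A.support s, x j ∈ f j) ∧ x ∈ A.subspace F s

/-- The number of `S`-marked multi-colorings of `A` associated to `m` with colors in `F`. -/
def markedCount [Fintype V] (A : IntArrangement V) (m : V → ℕ) (S : Finset V)
    (F : Type*) [Field F] : ℕ :=
  Nat.card {f : V → Multiset F // A.IsMarkedColoring m S f}

open Classical in
/-- The clan arrangement of `A` for a tuple `lam` of partitions `lam i` of `m i`. It lives in the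
space with one coordinate `x_{i,a}` for each `i` and each `1 ≤ a ≤ ℓ(lam i)`. Its members are
* the hyperplanes `x_{i,a} = x_{i,b}` for `a ≠ b`;
* for each `s` with `supp(H_s) ⊆ supp(m)` and each choice `k` of an index `k_i` for all
  `i ∈ supp(m)`, the subspace obtained from the equations of `H_s` by substituting
  `x_{i,k_i}` for `x_i`. -/
def clan (A : IntArrangement V) [Finite V] {m : V → ℕ} (lam : (i : V) → (m i).Partition) :
    IntArrangement (Σ i : V, Fin (Multiset.card (lam i).parts)) where
  Idx :=
    (Σ i : V, {ab : Fin (Multiset.card (lam i).parts) × Fin (Multiset.card (lam i).parts) //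
      ab.1 ≠ ab.2}) ⊕
    ({s : A.Idx // ∀ i ∈ A.support s, m i ≠ 0} ×
      ((i : {i : V // m i ≠ 0}) → Fin (Multiset.card (lam i.1).parts)))
  finite_idx := by
    have := A.finite_idx
    infer_instance
  r
    | Sum.inl _ => 1
    | Sum.inr t => A.r t.1.1
  L
    | Sum.inl t => fun _ v =>
        (if v = ⟨t.1, t.2.1.1⟩ then 1 else 0) - (if v = ⟨t.1, t.2.1.2⟩ then 1 else 0)
    | Sum.inr t => fun j v =>
        if ∃ h : m v.1 ≠ 0, t.2 ⟨v.1, h⟩ = v.2 then A.L t.1.1 j v.1 else 0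

end IntArrangement

open Classical in
/-- The set `S(m)` of tuples of partitions `lam i` of `m i` with `lam i = (1, …, 1)` for all
`i ∉ S`. -/
def markedPartitions {V : Type} [Fintype V] (m : V → ℕ) (S : Finset V) :
    Finset ((i : V) → (m i).Partition) :=
  Finset.univ.filter fun lam => ∀ i ∉ S, (lam i).parts = Multiset.replicate (m i) 1

/-- The product over all `i` in the support of `m` and all `k ≥ 1` of `d_k !`, where `d_k` is the
number of parts of `lam i` equal to `k` (which vanishes for `k > m i`). -/
def multiplicityFactorials {V : Type} [Fintype V] {m : V → ℕ}
    (lam : (i : V) → (m i).Partition) : ℕ :=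
  ∏ i with m i ≠ 0, ∏ k ∈ Finset.Icc 1 (m i), (Multiset.count k (lam i).parts).factorial

end

/-! Reading a coloring's multiplicities at each node gives its shape, a tuple $\underline\lambda\in
S(\mathbf m)$. Listing its distinct colors along the parts gives a point over $\mathbb F_q$ off the
clan arrangement: the hyperplanes $x_{ir}=x_{it}$ keep the listed colors distinct, the other
subspaces express avoidance (`mem_clan_complement_iff`). Each coloring of shape $\underline\lambda$
has $\prod d_k!$ listings, as equal parts may be permuted (`card_clan_complement`). Summing over
shapes reduces the theorem to counting complement points.

That count is the finite field method (`exists_card_complement_eq`). Inclusion-exclusion over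
$\mathbb F_q$ and Whitney's theorem over $\mathbb R$ give the same alternating sum over subfamilies,
with exponents the dimensions of intersections; these agree for large $p$ because the nullity of an
integer matrix does (`Matrix.exists_finrank_ker_map_eq`). The polynomial is unique since it is
determined at infinitely many primes. -/

/-! ### Nullity of integer matrices in large characteristic -/

-- Over $\mathbb Q$, a section of the map onto its range, extended to the whole space, is a
-- generalized inverse; $d$ clears its denominators.
open Classical in
theorem Matrix.exists_int_generalizedInverse {ι κ : Type*} [Fintype ι] [Fintype κ]
    (M : Matrix κ ι ℤ) : ∃ (d : ℤ) (G : Matrix ι κ ℤ), d ≠ 0 ∧ M * G * M = d • M := by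
  let MQ : Matrix κ ι ℚ := M.map (Int.castRingHom ℚ)
  let f := Matrix.toLin' MQ
  obtain ⟨g, hg⟩ := f.rangeRestrict.exists_rightInverse_of_surjective f.range_rangeRestrict
  obtain ⟨g', hg'⟩ := LinearMap.exists_extend g
  have hfgf : f ∘ₗ g' ∘ₗ f = f := by
    ext1 i
    refine LinearMap.ext fun x => ?_
    have h1 : g' (f (LinearMap.single ℚ (fun _ => ℚ) i x)) =
        g (f.rangeRestrict (LinearMap.single ℚ (fun _ => ℚ) i x)) := by
      rw [← hg']; rfl
    have h2 := LinearMap.congr_fun hg (f.rangeRestrict (LinearMap.single ℚ (fun _ => ℚ) i x))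
    have h3 := congrArg Subtype.val h2
    simp only [LinearMap.comp_apply]
    rw [h1]
    exact h3
  let GQ := LinearMap.toMatrix' g'
  have hM : MQ * GQ * MQ = MQ := by
    apply Matrix.toLin'.injective
    rw [Matrix.toLin'_mul, Matrix.toLin'_mul, Matrix.toLin'_toMatrix', LinearMap.comp_assoc]
    exact hfgf
  obtain ⟨b, hb⟩ := IsLocalization.exist_integer_multiples_of_finite (nonZeroDivisors ℤ)
    (fun ij : ι × κ => GQ ij.1 ij.2)
  choose G hG using hb
  refine ⟨b, Matrix.of fun i j => G (i, j), nonZeroDivisors.ne_zero b.2, ?_⟩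
  have hGQ : (Matrix.of fun i j => G (i, j)).map (Int.castRingHom ℚ) = (b : ℤ) • GQ := by
    ext i j
    exact hG (i, j)
  apply Matrix.map_injective (f := Int.castRingHom ℚ) Int.cast_injective
  beta_reduce
  rw [Matrix.map_mul, Matrix.map_mul, hGQ, Matrix.mul_smul, Matrix.smul_mul]
  change (b : ℤ) • (MQ * GQ * MQ) = _
  rw [hM]
  ext i j
  simp [MQ]

/-- The map $1-d^{-1}GM$ is a projection onto $\ker M$, so its trace is the nullity. After
multiplication by $d$ this trace is the image of an integer that does not depend on $K$. -/
theorem Matrix.mul_finrank_ker_eq_of_generalizedInverse {ι κ K : Type*} [Fintype ι]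
    [DecidableEq ι] [Fintype κ] [Field K] {M : Matrix κ ι ℤ} {G : Matrix ι κ ℤ} {d : ℤ}
    (h : M * G * M = d • M)
    (hd : (d : K) ≠ 0) :
    (d : K) * (Module.finrank K (LinearMap.ker (Matrix.toLin' (M.map (Int.castRingHom K)))) : K) =
      ((d * Fintype.card ι - (G * M).trace : ℤ) : K) := by
  classical
  set MK := M.map (Int.castRingHom K) with hMK
  set GK := G.map (Int.castRingHom K) with hGK
  have hK : MK * GK * MK = (d : K) • MK := by
    rw [hMK, hGK, ← Matrix.map_mul, ← Matrix.map_mul, h]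
    ext i j
    simp
  have hproj : LinearMap.IsProj (LinearMap.ker (Matrix.toLin' MK))
      (Matrix.toLin' (1 - (d : K)⁻¹ • (GK * MK))) := by
    constructor
    · intro x
      rw [LinearMap.mem_ker, ← LinearMap.comp_apply, ← Matrix.toLin'_mul, Matrix.mul_sub,
        Matrix.mul_smul, ← Matrix.mul_assoc, hK, smul_smul, inv_mul_cancel₀ hd]
      simp
    · intro x hx
      rw [LinearMap.mem_ker] at hx
      rw [map_sub, map_smul, Matrix.toLin'_mul]
      simp [hx]
  have ht := hproj.trace
  rw [Matrix.trace_toLin'_eq, Matrix.trace_sub, Matrix.trace_one, Matrix.trace_smul] at ht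
  have htr : (GK * MK).trace = (((G * M).trace : ℤ) : K) := by
    rw [hMK, hGK, ← Matrix.map_mul]
    simp [Matrix.trace]
  rw [← ht, htr, smul_eq_mul, mul_sub, mul_inv_cancel_left₀ hd]
  push_cast
  ring

/-- The nullity of an integer matrix over a field of large characteristic is its real nullity. -/
theorem Matrix.exists_finrank_ker_map_eq {ι κ : Type*} [Fintype ι] [DecidableEq ι] [Fintype κ]
    (M : Matrix κ ι ℤ) :
    ∃ N : ℕ, ∀ p : ℕ, N < p → ∀ (F : Type u) [Field F] [CharP F p],
      Module.finrank F (LinearMap.ker (Matrix.toLin' (M.map (Int.castRingHom F)))) =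
        Module.finrank ℝ (LinearMap.ker (Matrix.toLin' (M.map (Int.castRingHom ℝ)))) := by
  obtain ⟨d, G, hd, h⟩ := M.exists_int_generalizedInverse
  -- Beyond $|d|$, the integer $d$ is invertible in `F`; beyond the number of columns, both
  -- nullities are less than $p$, so their congruence mod $p$ is an equality.
  refine ⟨max d.natAbs (Fintype.card ι), fun p hp F _ _ => ?_⟩
  have hdF : (d : F) ≠ 0 := by
    rw [Ne, CharP.intCast_eq_zero_iff F p]
    intro hdvd
    have := Int.le_of_dvd (by positivity) ((dvd_abs _ _).2 hdvd)
    rw [Int.abs_eq_natAbs] at this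
    omega
  have hF := Matrix.mul_finrank_ker_eq_of_generalizedInverse h hdF
  have hR := Matrix.mul_finrank_ker_eq_of_generalizedInverse h
    (K := ℝ) (Int.cast_ne_zero.2 hd)
  have hleF : Module.finrank F (LinearMap.ker (Matrix.toLin' (M.map (Int.castRingHom F)))) ≤
        Fintype.card ι :=
    (Submodule.finrank_le _).trans_eq (Module.finrank_fintype_fun_eq_card F)
  have hleR : Module.finrank ℝ (LinearMap.ker (Matrix.toLin' (M.map (Int.castRingHom ℝ)))) ≤
        Fintype.card ι :=
    (Submodule.finrank_le _).trans_eq (Module.finrank_fintype_fun_eq_card ℝ)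
  set a := Module.finrank F (LinearMap.ker (Matrix.toLin' (M.map (Int.castRingHom F))))
  set b := Module.finrank ℝ (LinearMap.ker (Matrix.toLin' (M.map (Int.castRingHom ℝ))))
  have hZ : d * (b : ℤ) = d * Fintype.card ι - (G * M).trace := by exact_mod_cast hR
  have hF' : (d : F) * a = d * b := by
    rw [← Int.cast_natCast b, ← Int.cast_mul, hZ, hF]
  have hab := (CharP.natCast_eq_natCast F p).1 (mul_left_cancel₀ hdF hF')
  exact Nat.ModEq.eq_of_lt_of_lt hab (by omega) (by omega)

/-! ### Intersections and complements over finite fields -/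

namespace IntArrangement

variable {V : Type} [Fintype V]

theorem exists_finrank_inf_subspace_eq (A : IntArrangement V) (T : Finset A.Idx) :
    ∃ N : ℕ, ∀ p : ℕ, N < p → ∀ (F : Type u) [Field F] [CharP F p],
      Module.finrank F (T.inf (A.subspace F) : Submodule F (V → F)) =
        Module.finrank ℝ (T.inf (A.subspace ℝ) : Submodule ℝ (V → ℝ)) := by
  classical
  -- Stacking all equations of the members in `T` makes their intersection the kernel of one integer
  -- matrix.
  let M : Matrix (Σ s : T, Fin (A.r s)) V ℤ := Matrix.of fun sj v => A.L sj.1 sj.2 v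
  have key : ∀ (K : Type _) [Field K], T.inf (A.subspace K) =
      LinearMap.ker (Matrix.toLin' (M.map (Int.castRingHom K))) := by
    intro K _
    ext x
    rw [Submodule.mem_finsetInf, LinearMap.mem_ker, funext_iff]
    exact ⟨fun h sj => h sj.1.1 sj.1.2 sj.2, fun h s hs j => h ⟨⟨s, hs⟩, j⟩⟩
  have keyR : T.inf (A.subspace ℝ) =
      LinearMap.ker (Matrix.toLin' (M.map (Int.castRingHom ℝ))) := by
    ext x
    rw [Submodule.mem_finsetInf, LinearMap.mem_ker, funext_iff]
    exact ⟨fun h sj => h sj.1.1 sj.1.2 sj.2, fun h s hs j => h ⟨⟨s, hs⟩, j⟩⟩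
  obtain ⟨N, hN⟩ := M.exists_finrank_ker_map_eq
  refine ⟨N, fun p hp F _ _ => ?_⟩
  rw [key F, keyR]
  exact hN p hp F

/-- The points over `K` that lie on no member of the arrangement. -/
def complement (A : IntArrangement V) (K : Type*) [Field K] : Set (V → K) :=
  {x | ∀ s, x ∉ A.subspace K s}

theorem card_complement_eq_sum (A : IntArrangement V) [Fintype A.Idx]
    (F : Type*) [Field F] [Fintype F] :
    (Nat.card (A.complement F) : ℤ) = ∑ T : Finset A.Idx,
      (-1) ^ T.card * (Fintype.card F : ℤ) ^
        Module.finrank F (T.inf (A.subspace F) : Submodule F (V → F)) := by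
  classical
  have h := Finset.inclusion_exclusion_card_inf_compl (Finset.univ : Finset A.Idx)
    (fun s => Finset.univ.filter fun x : V → F => x ∈ A.subspace F s)
  rw [Finset.powerset_univ] at h
  have h1 : Nat.card (A.complement F) = ((Finset.univ : Finset A.Idx).inf fun s =>
      (Finset.univ.filter fun x : V → F => x ∈ A.subspace F s)ᶜ).card := by
    rw [← Nat.card_eq_finsetCard]
    refine Nat.card_congr (Equiv.subtypeEquivRight fun x => ?_)
    simp [complement, Finset.mem_inf]
  rw [h1, h]
  refine Finset.sum_congr rfl fun T _ => ?_
  congr 1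
  rw [← Nat.cast_pow, ← Module.card_eq_pow_finrank (K := F)
    (V := (T.inf (A.subspace F) : Submodule F (V → F))), Fintype.card_subtype]
  congr 2
  ext x
  simp [Finset.mem_inf, Submodule.mem_finsetInf]

end IntArrangement

/-! ### Whitney's theorem for subspace arrangements -/

section Whitney

variable {E ι : Type*} [AddCommGroup E] [Module ℝ E]

theorem toDual_inf_mem_intersectionPoset {H : ι → Submodule ℝ E} {𝒜 : Finset (Submodule ℝ E)}
    (h𝒜 : ∀ W, W ∈ 𝒜 ↔ ∃ i, H i = W) (T : Finset ι) :
    OrderDual.toDual (T.inf H) ∈ intersectionPoset 𝒜 := by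
  classical
  refine Finset.mem_image.2 ⟨T.image H, ?_, ?_⟩
  · rw [Finset.mem_powerset]
    intro W hW
    obtain ⟨i, -, rfl⟩ := Finset.mem_image.1 hW
    exact (h𝒜 _).2 ⟨i, rfl⟩
  · rw [Finset.inf_image]
    rfl

open Classical in
/-- Whitney's theorem: the Möbius function of the intersection poset as an alternating sum over
the families of members with a given intersection. -/
theorem moebiusFromWhole_eq_sum [Fintype ι] (H : ι → Submodule ℝ E) (hH : ∀ i, H i ≠ ⊤)
    {𝒜 : Finset (Submodule ℝ E)} (h𝒜 : ∀ W, W ∈ 𝒜 ↔ ∃ i, H i = W) (X : intersectionPoset 𝒜) :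
    moebiusFromWhole 𝒜 X =
      ∑ T : Finset ι with T.inf H = OrderDual.ofDual X.1, (-1 : ℤ) ^ T.card := by
  let _ : LocallyFiniteOrder (intersectionPoset 𝒜) := Fintype.toLocallyFiniteOrder
  have hwhole : ∀ X, wholeSpace 𝒜 ≤ X := fun X =>
    show (OrderDual.ofDual X.1 : Submodule ℝ E) ≤ ⊤ from le_top
  -- The alternating sums satisfy the recursion that defines the Möbius function.
  have hsum : ∀ X : intersectionPoset 𝒜,
      ∑ Y ∈ Finset.Icc (wholeSpace 𝒜) X,
        ∑ T : Finset ι with T.inf H = OrderDual.ofDual Y.1, (-1 : ℤ) ^ T.card =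
      if wholeSpace 𝒜 = X then 1 else 0 := by
    intro X
    -- The families whose intersection contains `X` are exactly the subsets of `U`. Their signed
    -- count vanishes unless `U` is empty, which, all members being proper, happens only for the
    -- whole space.
    let U : Finset ι := Finset.univ.filter fun i => OrderDual.ofDual X.1 ≤ H i
    have h1 : ∑ Y ∈ Finset.Icc (wholeSpace 𝒜) X,
        ∑ T : Finset ι with T.inf H = OrderDual.ofDual Y.1, (-1 : ℤ) ^ T.card =
        ∑ T ∈ U.powerset, (-1 : ℤ) ^ T.card := by
      rw [← Finset.sum_fiberwise_of_maps_to (t := Finset.Icc (wholeSpace 𝒜) X)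
        (g := fun T => (⟨OrderDual.toDual (T.inf H),
          toDual_inf_mem_intersectionPoset h𝒜 T⟩ : intersectionPoset 𝒜))]
      · refine Finset.sum_congr rfl fun Y hY => Finset.sum_congr ?_ fun _ _ => rfl
        ext T
        simp only [Finset.mem_filter, Finset.mem_univ, true_and, Finset.mem_powerset]
        constructor
        · intro hT
          refine ⟨fun i hi => ?_, Subtype.ext (congrArg OrderDual.toDual hT)⟩
          have hle : OrderDual.ofDual X.1 ≤ OrderDual.ofDual Y.1 := (Finset.mem_Icc.1 hY).2
          rw [Finset.mem_filter]
          exact ⟨Finset.mem_univ _, hle.trans (hT ▸ Finset.inf_le hi)⟩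
        · rintro ⟨-, rfl⟩
          rfl
      · intro T hT
        refine Finset.mem_Icc.2 ⟨hwhole _, ?_⟩
        change OrderDual.ofDual X.1 ≤ T.inf H
        exact Finset.le_inf fun i hi => (Finset.mem_filter.1 (Finset.mem_powerset.1 hT hi)).2
    rw [h1, Finset.sum_powerset_neg_one_pow_card]
    congr 1
    rw [eq_iff_iff]
    constructor
    · intro hU
      obtain ⟨B, hB, hBX⟩ := Finset.mem_image.1 X.2
      refine Subtype.ext ?_
      rw [← hBX]
      refine congrArg OrderDual.toDual ?_
      symm
      refine Finset.inf_eq_top_iff _ _ |>.2 fun W hW => ?_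
      obtain ⟨i, rfl⟩ := (h𝒜 W).1 (Finset.mem_powerset.1 hB hW)
      have : i ∈ U := by
        rw [Finset.mem_filter, ← hBX]
        exact ⟨Finset.mem_univ _, Finset.inf_le (f := id) hW⟩
      rw [hU] at this
      exact absurd this (Finset.notMem_empty i)
    · rintro rfl
      refine Finset.filter_eq_empty_iff.2 fun i _ hi => hH i (top_le_iff.1 hi)
  change IncidenceAlgebra.mu ℤ (wholeSpace 𝒜) X = _
  induction X using WellFoundedLT.induction with
  | ind X ih =>
    have h1 := IncidenceAlgebra.sum_Icc_mu_right (𝕜 := ℤ) (wholeSpace 𝒜) X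
    have h2 := hsum X
    rw [← h1, Finset.Icc_eq_cons_Ico (hwhole X), Finset.sum_cons, Finset.sum_cons,
      Finset.sum_congr rfl fun Y hY => ih Y (Finset.mem_Ico.1 hY).2] at h2
    exact (add_right_cancel h2).symm

open Classical in
theorem charPolyOfSubspaces_eq_sum [Fintype ι] (H : ι → Submodule ℝ E) (hH : ∀ i, H i ≠ ⊤)
    {𝒜 : Finset (Submodule ℝ E)} (h𝒜 : ∀ W, W ∈ 𝒜 ↔ ∃ i, H i = W) :
    charPolyOfSubspaces 𝒜 = ∑ T : Finset ι, Polynomial.C ((-1 : ℤ) ^ T.card) *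
      Polynomial.X ^ Module.finrank ℝ (T.inf H : Submodule ℝ E) := by
  rw [charPolyOfSubspaces, ← Finset.sum_fiberwise (s := Finset.univ)
    (g := fun T => (⟨OrderDual.toDual (T.inf H),
      toDual_inf_mem_intersectionPoset h𝒜 T⟩ : intersectionPoset 𝒜))]
  refine Finset.sum_congr rfl fun X _ => ?_
  rw [moebiusFromWhole_eq_sum H hH h𝒜, map_sum, Finset.sum_mul]
  refine Finset.sum_congr ?_ fun T hT => ?_
  · ext T
    simp only [Finset.mem_filter, Finset.mem_univ, true_and, Subtype.ext_iff]
    rfl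
  · rw [← (Finset.mem_filter.1 hT).2]
    rfl

end Whitney

/-! ### The finite field method -/

namespace IntArrangement

variable {V : Type} [Fintype V]

/-- The finite field method: over fields of large characteristic, the characteristic polynomial
counts the points of the complement. -/
theorem exists_card_complement_eq (A : IntArrangement V) (hA : ∀ s, A.subspace ℝ s ≠ ⊤) :
    ∃ N : ℕ, ∀ p : ℕ, N < p → ∀ (F : Type u) [Field F] [Fintype F] [CharP F p],
      (Nat.card (A.complement F) : ℤ) = A.charPoly.eval (Fintype.card F : ℤ) := by
  classical
  have := A.finite_idx
  have := Fintype.ofFinite A.Idx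
  choose N hN using A.exists_finrank_inf_subspace_eq
  refine ⟨Finset.univ.sup N, fun p hp F _ _ _ => ?_⟩
  rw [card_complement_eq_sum, charPoly, charPolyOfSubspaces_eq_sum (A.subspace ℝ) hA
    (by simp [realSubspaces]), Polynomial.eval_finsetSum]
  refine Finset.sum_congr rfl fun T _ => ?_
  rw [hN T p ((Finset.le_sup (Finset.mem_univ T)).trans_lt hp) F]
  simp

end IntArrangement

/-! ### Listings of a multiset along its multiplicities -/

section Multiplicities

theorem Multiset.count_map_univ {α γ : Type*} [Fintype α] [DecidableEq γ] (f : α → γ) (k : γ)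
    [Fintype {a // f a = k}] : (Finset.univ.val.map f).count k = Fintype.card {a // f a = k} := by
  rw [← Nat.card_eq_fintype_card, Nat.card_eq_fintype_card, Multiset.count_map,
    Fintype.card_subtype, Finset.card_def, Finset.filter_val]
  simp only [eq_comm]

/-- Equal multisets of values mean fibres of equal size, which can be matched one by one. -/
theorem exists_equiv_of_map_univ_eq {α β γ : Type*} [Fintype α] [Fintype β] {f : α → γ}
    {g : β → γ} (h : Finset.univ.val.map f = Finset.univ.val.map g) :
    ∃ e : α ≃ β, ∀ a, g (e a) = f a := by
  classical
  have hcard : ∀ k, Fintype.card {a // f a = k} = Fintype.card {b // g b = k} := fun k => by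
    rw [← Multiset.count_map_univ, ← Multiset.count_map_univ, h]
  let e : ∀ k, {a // f a = k} ≃ {b // g b = k} := fun k => Fintype.equivOfCardEq (hcard k)
  refine ⟨((Equiv.sigmaFiberEquiv f).symm.trans (Equiv.sigmaCongrRight e)).trans
    (Equiv.sigmaFiberEquiv g), fun a => (e (f a) ⟨a, rfl⟩).2⟩

variable {α F : Type*} [Fintype α]

/-- The multiset in which each `x a` is repeated `w a` times. -/
def weightedMultiset (w : α → ℕ) (x : α → F) : Multiset F :=
  ∑ a, w a • {x a}

theorem weightedMultiset_comp (w : α → ℕ) (x : α → F) (σ : Equiv.Perm α)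
    (hσ : ∀ a, w (σ a) = w a) : weightedMultiset w (x ∘ σ) = weightedMultiset w x := by
  rw [weightedMultiset, weightedMultiset, ← Equiv.sum_comp σ fun a => w a • ({x a} : Multiset F)]
  exact Finset.sum_congr rfl fun a _ => by rw [hσ]; rfl

theorem mem_weightedMultiset {w : α → ℕ} (hw : ∀ a, w a ≠ 0) {x : α → F} {c : F} :
    c ∈ weightedMultiset w x ↔ ∃ a, x a = c := by
  simp [weightedMultiset, Multiset.mem_sum, Multiset.mem_nsmul, hw, eq_comm]

theorem card_weightedMultiset (w : α → ℕ) (x : α → F) :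
    (weightedMultiset w x).card = ∑ a, w a := by
  simp [weightedMultiset]

variable [DecidableEq F]

theorem count_weightedMultiset (w : α → ℕ) {x : α → F} (hx : Function.Injective x) (a : α) :
    (weightedMultiset w x).count (x a) = w a := by
  classical
  simp [weightedMultiset, Multiset.count_sum', Multiset.count_singleton, hx.eq_iff]

theorem dedup_map_count_weightedMultiset {w : α → ℕ} (hw : ∀ a, w a ≠ 0) {x : α → F}
    (hx : Function.Injective x) :
    (weightedMultiset w x).dedup.map (weightedMultiset w x).count = Finset.univ.val.map w := by
  have h : (weightedMultiset w x).dedup = Finset.univ.val.map x := by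
    refine (Multiset.Nodup.ext (Multiset.nodup_dedup _)
      (Finset.univ.nodup.map hx)).2 fun c => ?_
    simp [mem_weightedMultiset hw]
  conv_lhs => rw [h, Multiset.map_map]
  exact Multiset.map_congr rfl fun a _ => count_weightedMultiset w hx a

theorem exists_injective_weightedMultiset_eq {w : α → ℕ} {g : Multiset F}
    (h : g.dedup.map g.count = Finset.univ.val.map w) :
    ∃ x : α → F, Function.Injective x ∧ weightedMultiset w x = g := by
  have h1 : Finset.univ.val.map w =
      (Finset.univ : Finset {c // c ∈ g.toFinset}).val.map fun c => g.count c.1 := by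
    rw [← h, Finset.univ_eq_attach, Finset.attach_val]
    exact (Multiset.attach_map_val' g.toFinset.val g.count).symm
  obtain ⟨e, he⟩ := exists_equiv_of_map_univ_eq h1
  refine ⟨fun a => (e a).1, Subtype.val_injective.comp e.injective, ?_⟩
  conv_rhs => rw [← Multiset.toFinset_sum_count_nsmul_eq g]
  rw [weightedMultiset, ← Finset.sum_coe_sort g.toFinset, ← Equiv.sum_comp e]
  exact Finset.sum_congr rfl fun a _ => by rw [he a]

/-- The number of ways to list the elements of a multiset along its multiplicities. -/
theorem card_injective_weightedMultiset_eq {w : α → ℕ} (hw : ∀ a, w a ≠ 0) {m : ℕ}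
    (hm : ∀ a, w a ≤ m) {g : Multiset F} (h : g.dedup.map g.count = Finset.univ.val.map w) :
    Nat.card {x : α → F // Function.Injective x ∧ weightedMultiset w x = g} =
      ∏ k ∈ Finset.Icc 1 m, ((Finset.univ.val.map w).count k).factorial := by
  classical
  obtain ⟨x₀, hinj, rfl⟩ := exists_injective_weightedMultiset_eq h
  -- Once one listing `x₀` is fixed, every other arises from it by a unique permutation preserving
  -- `w`; so the task is to count the stabilizer of `w`.
  let Φ : {σ : Equiv.Perm α // w ∘ σ = w} →
      {x : α → F // Function.Injective x ∧ weightedMultiset w x = weightedMultiset w x₀} :=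
    fun σ => ⟨x₀ ∘ σ.1, hinj.comp σ.1.injective,
      weightedMultiset_comp w x₀ σ.1 (congrFun σ.2)⟩
  have hΦ : Function.Bijective Φ := by
    constructor
    · intro σ τ hst
      refine Subtype.ext (Equiv.ext fun a => hinj ?_)
      exact congrFun (congrArg Subtype.val hst) a
    · rintro ⟨x, hx, hxg⟩
      have hex : ∀ a, ∃ b, x₀ b = x a := fun a => by
        rw [← mem_weightedMultiset hw, ← hxg, mem_weightedMultiset hw]
        exact ⟨a, rfl⟩
      choose σ hσ using hex
      have hσinj : Function.Injective σ := fun a b hab => hx (by rw [← hσ, ← hσ, hab])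
      refine ⟨⟨Equiv.ofBijective σ (Finite.injective_iff_bijective.1 hσinj), ?_⟩,
        Subtype.ext (funext hσ)⟩
      funext a
      change w (σ a) = w a
      rw [← count_weightedMultiset w hinj, hσ, ← hxg, count_weightedMultiset w hx]
  rw [← Nat.card_congr (Equiv.ofBijective Φ hΦ), Nat.card_eq_fintype_card,
    DomMulAct.stabilizer_card']
  -- The stabilizer formula runs over the values taken by `w`; the remaining `k` contribute $0!=1$.
  refine (Finset.prod_congr rfl fun k _ => ?_).trans
    (Finset.prod_subset (f := fun k => ((Finset.univ.val.map w).count k).factorial) ?_ ?_)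
  · rw [Multiset.count_map_univ]
  · intro k hk
    obtain ⟨a, -, rfl⟩ := Finset.mem_image.1 hk
    exact Finset.mem_Icc.2 ⟨Nat.one_le_iff_ne_zero.2 (hw a), hm a⟩
  · intro k _ hk
    rw [Multiset.count_eq_zero_of_notMem, Nat.factorial_zero]
    simpa using hk

end Multiplicities

/-! ### Parts of a partition as an indexed family -/

namespace Nat.Partition

theorem exists_univ_map_eq_parts (s : Multiset ℕ) :
    ∃ w : Fin s.card → ℕ, Finset.univ.val.map w = s := by
  induction s using Quotient.inductionOn with
  | h l => exact ⟨l.get,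
      (Fin.univ_val_map l.get).trans (congrArg _ (List.ofFn_get l))⟩

/-- The parts of a partition, as a family indexed by `Fin`. -/
noncomputable def part {m : ℕ} (l : m.Partition) : Fin l.parts.card → ℕ :=
  (exists_univ_map_eq_parts l.parts).choose

theorem univ_map_part {m : ℕ} (l : m.Partition) : Finset.univ.val.map l.part = l.parts :=
  (exists_univ_map_eq_parts l.parts).choose_spec

theorem part_mem {m : ℕ} (l : m.Partition) (a) : l.part a ∈ l.parts := by
  have h := Multiset.mem_map_of_mem l.part (Finset.mem_univ_val a)
  rwa [univ_map_part] at h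

theorem part_ne_zero {m : ℕ} (l : m.Partition) (a) : l.part a ≠ 0 :=
  (l.parts_pos (l.part_mem a)).ne'

theorem sum_part {m : ℕ} (l : m.Partition) : ∑ a, l.part a = m := by
  rw [Finset.sum_eq_multiset_sum, univ_map_part, l.parts_sum]

theorem part_le {m : ℕ} (l : m.Partition) (a) : l.part a ≤ m :=
  (Finset.single_le_sum (fun _ _ => Nat.zero_le _) (Finset.mem_univ a)).trans_eq l.sum_part

theorem card_parts_pos {m : ℕ} (l : m.Partition) (hm : m ≠ 0) : 0 < l.parts.card := by
  rw [Multiset.card_pos]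
  intro h
  exact hm (by rw [← l.parts_sum, h, Multiset.sum_zero])

end Nat.Partition

/-! ### Complements of clan arrangements -/

namespace IntArrangement

section ClanColoring

variable {V : Type} {m : V → ℕ} (lam : (i : V) → (m i).Partition) {F : Type*}

/-- The multiset family obtained by repeating the coordinates of `x` according to the parts. -/
noncomputable def clanColoring (x : (Σ i : V, Fin (lam i).parts.card) → F) (i : V) : Multiset F :=
  weightedMultiset (lam i).part fun a => x ⟨i, a⟩

theorem mem_clanColoring {x : (Σ i : V, Fin (lam i).parts.card) → F} {i : V} {c : F} :
    c ∈ clanColoring lam x i ↔ ∃ a, x ⟨i, a⟩ = c :=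
  mem_weightedMultiset (lam i).part_ne_zero

end ClanColoring

variable {V : Type} [Fintype V]

/-- Whitney's theorem needs proper members. A nonzero coefficient of $H_s$ sits at a node of its
support, hence of $\mathrm{supp}(\mathbf m)$, and so survives the substitution; a unit vector then
violates the equation. -/
theorem clan_subspace_ne_top (A : IntArrangement V) (hA : ∀ s, A.subspace ℝ s ≠ ⊤) {m : V → ℕ}
    (lam : (i : V) → (m i).Partition) (t) : (A.clan lam).subspace ℝ t ≠ ⊤ := by
  classical
  suffices h : ∃ j v, (A.clan lam).L t j v ≠ 0 by
    obtain ⟨j, v, hv⟩ := h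
    intro htop
    have hmem : (Pi.single v 1 : _ → ℝ) ∈ (A.clan lam).subspace ℝ t := htop ▸ Submodule.mem_top
    have := hmem j
    simp only [Pi.single_apply, mul_ite, mul_one, mul_zero, Finset.sum_ite_eq', Finset.mem_univ,
      if_true] at this
    exact hv (Int.cast_eq_zero.1 this)
  rcases t with ⟨i, ⟨⟨a, b⟩, hab⟩⟩ | ⟨⟨s, hs⟩, k⟩
  · refine ⟨(0 : Fin 1), ⟨i, a⟩, ?_⟩
    have : (⟨i, a⟩ : Σ i : V, Fin (lam i).parts.card) ≠ ⟨i, b⟩ := fun h =>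
      hab (eq_of_heq (Sigma.mk.inj h).2)
    simp [clan, this]
  · obtain ⟨j, v, hv⟩ : ∃ j v, A.L s j v ≠ 0 := by
      by_contra! h
      exact hA s (Submodule.eq_top_iff'.2 fun x j => by simp [h])
    have hm := hs v ⟨j, hv⟩
    exact ⟨j, ⟨v, k ⟨v, hm⟩⟩, by simp [clan, hm, hv]⟩

variable {m : V → ℕ} (lam : (i : V) → (m i).Partition) {F : Type*} [Field F]

open Classical in
theorem mem_clan_subspace_inl_iff (A : IntArrangement V)
    (x : (Σ i : V, Fin (lam i).parts.card) → F) (i : V) (ab) :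
    x ∈ (A.clan lam).subspace F (Sum.inl ⟨i, ab⟩) ↔ x ⟨i, ab.1.1⟩ = x ⟨i, ab.1.2⟩ := by
  have h : ∑ v, (((if v = ⟨i, ab.1.1⟩ then 1 else 0) -
      (if v = ⟨i, ab.1.2⟩ then 1 else 0) : ℤ) : F) * x v = x ⟨i, ab.1.1⟩ - x ⟨i, ab.1.2⟩ := by
    simp [sub_mul, Finset.sum_sub_distrib]
  rw [← sub_eq_zero, ← h]
  exact ⟨fun hx => hx (0 : Fin 1), fun hx _ => hx⟩

open Classical in
theorem mem_clan_subspace_inr_iff (A : IntArrangement V)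
    (x : (Σ i : V, Fin (lam i).parts.card) → F) (t) :
    x ∈ (A.clan lam).subspace F (Sum.inr t) ↔
      (fun i => if h : m i ≠ 0 then x ⟨i, t.2 ⟨i, h⟩⟩ else 0) ∈ A.subspace F t.1.1 := by
  refine forall_congr' fun j => ?_
  refine Eq.congr ?_ rfl
  rw [Fintype.sum_sigma]
  refine Finset.sum_congr rfl fun i _ => ?_
  by_cases h : m i = 0
  · simp [clan, h]
  · rw [Finset.sum_eq_single (t.2 ⟨i, h⟩)]
    · simp [clan, h]
    · intro a _ ha
      simp [clan, h, ha.symm]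
    · simp

theorem mem_clan_complement_iff (A : IntArrangement V)
    (x : (Σ i : V, Fin (lam i).parts.card) → F) :
    x ∈ (A.clan lam).complement F ↔ (∀ i, Function.Injective fun a => x ⟨i, a⟩) ∧
      ∀ s, ¬ ∃ y : V → F, (∀ j ∈ A.support s, y j ∈ clanColoring lam x j) ∧
        y ∈ A.subspace F s := by
  classical
  simp only [mem_clanColoring]
  constructor
  · intro hx
    refine ⟨fun i a b hab => ?_, ?_⟩
    · by_contra hne
      exact hx (Sum.inl ⟨i, ⟨(a, b), hne⟩⟩) ((mem_clan_subspace_inl_iff lam A x i _).2 hab)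
    · rintro s ⟨y, hy, hys⟩
      -- A node with $m_i=0$ has no color to choose, so a subspace whose support contains one is
      -- avoided automatically.
      have hs : ∀ i ∈ A.support s, m i ≠ 0 := by
        intro i hi hmi
        obtain ⟨a, -⟩ := hy i hi
        exact (lam i).part_ne_zero a (Nat.le_zero.1 (hmi ▸ (lam i).part_le a))
      -- The clan subspace needs an index at every node of $\mathrm{supp}(\mathbf m)$; off the
      -- support of `s` any index serves, and one exists because $m_i\ne0$.
      have hk : ∀ i : {i : V // m i ≠ 0}, ∃ a : Fin (lam i.1).parts.card,
          i.1 ∈ A.support s → x ⟨i.1, a⟩ = y i.1 := by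
        intro i
        by_cases hi : i.1 ∈ A.support s
        · obtain ⟨a, ha⟩ := hy i.1 hi
          exact ⟨a, fun _ => ha⟩
        · exact ⟨⟨0, (lam i.1).card_parts_pos i.2⟩, fun h => absurd h hi⟩
      choose k hk using hk
      refine hx (Sum.inr (⟨s, hs⟩, k)) ((mem_clan_subspace_inr_iff lam A x _).2 fun j => ?_)
      refine (Finset.sum_congr rfl fun i _ => ?_).trans (hys j)
      beta_reduce
      by_cases hi : i ∈ A.support s
      · rw [dif_pos (hs i hi), hk ⟨i, hs i hi⟩ hi]
      · have h0 : A.L s j i = 0 := by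
          by_contra h
          exact hi ⟨j, h⟩
        rw [h0, Int.cast_zero, zero_mul, zero_mul]
  · rintro ⟨hinj, hav⟩ (⟨i, ab⟩ | ⟨⟨s, hs⟩, k⟩) hmem
    · exact ab.2 (hinj i ((mem_clan_subspace_inl_iff lam A x i ab).1 hmem))
    · refine hav s ⟨_, fun i hi => ?_, (mem_clan_subspace_inr_iff lam A x _).1 hmem⟩
      exact ⟨k ⟨i, hs i hi⟩, by rw [dif_pos (hs i hi)]⟩

end IntArrangement

/-! ### Counting colorings by shape -/

namespace IntArrangement

variable {V : Type} [Fintype V] {m : V → ℕ} {F : Type*} [Field F]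

theorem isMarkedColoring_clanColoring (A : IntArrangement V) {S : Finset V}
    {lam : (i : V) → (m i).Partition} (hlam : lam ∈ markedPartitions m S)
    {x : (Σ i : V, Fin (lam i).parts.card) → F} (hx : x ∈ (A.clan lam).complement F) :
    A.IsMarkedColoring m S (clanColoring lam x) := by
  classical
  obtain ⟨hinj, hav⟩ := (mem_clan_complement_iff lam A x).1 hx
  refine ⟨fun i hi => ?_, fun i => ?_, hav⟩
  · rw [Multiset.nodup_iff_count_le_one]
    intro c
    by_cases hc : c ∈ clanColoring lam x i
    · obtain ⟨a, rfl⟩ := (mem_clanColoring lam).1 hc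
      have hp := (lam i).part_mem a
      rw [(Finset.mem_filter.1 hlam).2 i hi] at hp
      have := count_weightedMultiset (lam i).part (hinj i) a
      rw [Multiset.eq_of_mem_replicate hp] at this
      exact this.le
    · rw [Multiset.count_eq_zero_of_notMem hc]
      exact Nat.zero_le 1
  · rw [clanColoring, card_weightedMultiset, (lam i).sum_part]

open Classical in
theorem finite_isMarkedColoring [Finite F] (A : IntArrangement V) (S : Finset V) :
    Finite {f : V → Multiset F // A.IsMarkedColoring m S f} := by
  have := Fintype.ofFinite F
  have (i : V) : Finite (Sym F (m i)) := Finite.of_fintype _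
  refine Finite.of_injective (β := (i : V) → Sym F (m i))
    (fun f i => ⟨f.1 i, f.2.card_eq i⟩) fun f g hfg => ?_
  exact Subtype.ext (funext fun i => congrArg Subtype.val (congrFun hfg i))

/-- The tuple of partitions formed by the multiplicities of the colors. -/
noncomputable def IsMarkedColoring.shape [DecidableEq F] {A : IntArrangement V} {S : Finset V}
    {f : V → Multiset F} (hf : A.IsMarkedColoring m S f) (i : V) : (m i).Partition :=
  Nat.Partition.ofSym ⟨f i, hf.card_eq i⟩

theorem IsMarkedColoring.shape_mem_markedPartitions [DecidableEq F] {A : IntArrangement V}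
    {S : Finset V} {f : V → Multiset F} (hf : A.IsMarkedColoring m S f) :
    hf.shape ∈ markedPartitions m S := by
  classical
  refine Finset.mem_filter.2 ⟨Finset.mem_univ _, fun i hi => ?_⟩
  have hnd := hf.nodup i hi
  change (f i).dedup.map (f i).count = _
  rw [hnd.dedup, Multiset.map_congr rfl fun c hc => Multiset.count_eq_one_of_mem hnd hc,
    Multiset.map_const', hf.card_eq i]

open Classical in
/-- The points of the complement of a clan arrangement are the colorings of the given shape,
with their colors listed in all ways compatible with the multiplicities. -/
theorem card_clan_complement [Finite F] (A : IntArrangement V) {S : Finset V}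
    {lam : (i : V) → (m i).Partition} (hlam : lam ∈ markedPartitions m S) :
    Nat.card ((A.clan lam).complement F) =
      Nat.card {f : {f : V → Multiset F // A.IsMarkedColoring m S f} // f.2.shape = lam} *
        multiplicityFactorials lam := by
  have := A.finite_isMarkedColoring (F := F) (m := m) S
  have := Fintype.ofFinite {f : {f : V → Multiset F // A.IsMarkedColoring m S f} // f.2.shape = lam}
  let Φ : (A.clan lam).complement F →
      {f : {f : V → Multiset F // A.IsMarkedColoring m S f} // f.2.shape = lam} := fun x =>
    ⟨⟨clanColoring lam x.1, A.isMarkedColoring_clanColoring hlam x.2⟩, by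
      funext i
      refine Nat.Partition.ext ?_
      exact (dedup_map_count_weightedMultiset (lam i).part_ne_zero
        (((mem_clan_complement_iff lam A x.1).1 x.2).1 i)).trans (lam i).univ_map_part⟩
  have hfib : ∀ f, Nat.card {x // Φ x = f} = multiplicityFactorials lam := by
    intro f
    -- Avoidance depends only on the coloring, so once this is fixed, the listings at different
    -- nodes are independent and the fibre is a product.
    let e : {x // Φ x = f} ≃ ((i : V) → {y : Fin (lam i).parts.card → F //
        Function.Injective y ∧ weightedMultiset (lam i).part y = f.1.1 i}) :=
      { toFun := fun x i => ⟨fun a => x.1.1 ⟨i, a⟩,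
          ((mem_clan_complement_iff lam A x.1.1).1 x.1.2).1 i,
          congrFun (congrArg (fun g => g.1.1) x.2) i⟩
        invFun := fun y => by
          have hy : clanColoring lam (fun v => (y v.1).1 v.2) = f.1.1 :=
            funext fun i => (y i).2.2
          exact ⟨⟨fun v => (y v.1).1 v.2, (mem_clan_complement_iff lam A _).2
            ⟨fun i => (y i).2.1, fun s => by
              rw [hy]
              exact f.1.2.avoids s⟩⟩, Subtype.ext (Subtype.ext hy)⟩
        left_inv := fun x => rfl
        right_inv := fun y => rfl }
    rw [Nat.card_congr e, Nat.card_pi, multiplicityFactorials]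
    have hi : ∀ i, Nat.card {y : Fin (lam i).parts.card → F //
        Function.Injective y ∧ weightedMultiset (lam i).part y = f.1.1 i} =
        ∏ k ∈ Finset.Icc 1 (m i), ((lam i).parts.count k).factorial := by
      intro i
      have h : (f.1.1 i).dedup.map (f.1.1 i).count = Finset.univ.val.map (lam i).part := by
        rw [(lam i).univ_map_part, ← congrFun f.2 i]
        rfl
      rw [card_injective_weightedMultiset_eq (lam i).part_ne_zero (lam i).part_le h,
        (lam i).univ_map_part]
    rw [Finset.prod_congr rfl fun i _ => hi i]
    symm
    -- Nodes with $m_i=0$ contribute an empty product.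
    refine Finset.prod_subset (Finset.filter_subset _ _) fun i _ hm => ?_
    have hm0 : m i = 0 := by simpa using hm
    simp [hm0]
  rw [← Nat.card_congr (Equiv.sigmaFiberEquiv Φ), Nat.card_sigma,
    Finset.sum_congr rfl fun f _ => hfib f, Finset.sum_const, Finset.card_univ,
    Nat.card_eq_fintype_card, smul_eq_mul]

open Classical in
theorem markedCount_eq_sum [Finite F] (A : IntArrangement V) (S : Finset V) :
    A.markedCount m S F = ∑ lam ∈ markedPartitions m S,
      Nat.card {f : {f : V → Multiset F // A.IsMarkedColoring m S f} // f.2.shape = lam} := by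
  have := A.finite_isMarkedColoring (F := F) (m := m) S
  let Ψ : {f : V → Multiset F // A.IsMarkedColoring m S f} → markedPartitions m S :=
    fun f => ⟨f.2.shape, f.2.shape_mem_markedPartitions⟩
  rw [markedCount, ← Nat.card_congr (Equiv.sigmaFiberEquiv Ψ), Nat.card_sigma,
    ← Finset.sum_coe_sort (markedPartitions m S)]
  exact Finset.sum_congr rfl fun lam _ =>
    Nat.card_congr (Equiv.subtypeEquivRight fun f =>
      (Subtype.ext_iff : Ψ f = lam ↔ f.2.shape = lam.1))

end IntArrangement

theorem multiplicityFactorials_ne_zero {V : Type} [Fintype V] {m : V → ℕ}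
    (lam : (i : V) → (m i).Partition) : multiplicityFactorials lam ≠ 0 :=
  Finset.prod_ne_zero_iff.2 fun _ _ => Finset.prod_ne_zero_iff.2 fun _ _ => Nat.factorial_ne_zero _

/-! ### The counting formula and its polynomial -/

namespace IntArrangement

variable {V : Type} [Fintype V]

theorem exists_markedCount_eq (A : IntArrangement V) (hA : ∀ s, A.subspace ℝ s ≠ ⊤) (m : V → ℕ)
    (S : Finset V) :
    ∃ N : ℕ, ∀ p : ℕ, N < p → ∀ (F : Type u) [Field F] [Fintype F] [CharP F p],
      (A.markedCount m S F : ℚ) = ∑ lam ∈ markedPartitions m S,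
        Polynomial.aeval (Fintype.card F : ℚ) (A.clan lam).charPoly /
          (multiplicityFactorials lam : ℚ) := by
  choose N hN using fun lam : (i : V) → (m i).Partition =>
    (A.clan lam).exists_card_complement_eq.{u} (A.clan_subspace_ne_top hA lam)
  -- Only finitely many clan arrangements occur, so one bound serves them all.
  refine ⟨(markedPartitions m S).sup N, fun p hp F _ _ _ => ?_⟩
  rw [markedCount_eq_sum, Nat.cast_sum]
  refine Finset.sum_congr rfl fun lam hlam => ?_
  have h := hN lam p ((Finset.le_sup hlam).trans_lt hp) F
  rw [eq_div_iff (Nat.cast_ne_zero.2 (multiplicityFactorials_ne_zero lam)), ← Nat.cast_mul,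
    ← A.card_clan_complement hlam, ← Int.cast_natCast (Nat.card _), h,
    ← Int.cast_natCast (Fintype.card F)]
  exact (Polynomial.aeval_algebraMap_apply_eq_algebraMap_eval (A := ℚ)
    (Fintype.card F : ℤ) _).symm

end IntArrangement

theorem mainTheorem2 (n : ℕ) (A : IntArrangement (Fin n))
    (hA : ∀ s, A.subspace ℝ s ≠ ⊤)
    (m : Fin n → ℕ) (S : Finset (Fin n)) (hS : ∀ i ∈ S, m i ≠ 0) :
    (∃ N : ℕ, ∀ p : ℕ, p.Prime → N < p →
      ∀ (F : Type u) [Field F] [Fintype F] [CharP F p],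
        (A.markedCount m S F : ℚ) =
          ∑ lam ∈ markedPartitions m S,
            Polynomial.aeval (Fintype.card F : ℚ) (A.clan lam).charPoly /
              (multiplicityFactorials lam : ℚ)) ∧
    ∃ P : Polynomial ℂ,
      (∀ Q : Polynomial ℂ,
        (∃ N : ℕ, ∀ p : ℕ, p.Prime → N < p →
          ∀ (F : Type u) [Field F] [Fintype F] [CharP F p],
            (A.markedCount m S F : ℂ) = Q.eval (Fintype.card F : ℂ)) ↔ Q = P) ∧
      ∀ z : ℂ, P.eval z =
        ∑ lam ∈ markedPartitions m S,
          Polynomial.aeval z (A.clan lam).charPoly / (multiplicityFactorials lam : ℂ) := by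
  obtain ⟨N, hN⟩ := A.exists_markedCount_eq.{u} hA m S
  let P : Polynomial ℂ := ∑ lam ∈ markedPartitions m S,
    (A.clan lam).charPoly.map (Int.castRingHom ℂ) *
      Polynomial.C ((multiplicityFactorials lam : ℂ)⁻¹)
  have hP : ∀ z : ℂ, P.eval z = ∑ lam ∈ markedPartitions m S,
      Polynomial.aeval z (A.clan lam).charPoly / (multiplicityFactorials lam : ℂ) := by
    intro z
    rw [Polynomial.eval_finsetSum]
    refine Finset.sum_congr rfl fun lam _ => ?_
    rw [Polynomial.eval_mul, Polynomial.eval_C, Polynomial.eval_map, div_eq_mul_inv]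
    rfl
  have hPN : ∀ p : ℕ, N < p → ∀ (F : Type u) [Field F] [Fintype F] [CharP F p],
      (A.markedCount m S F : ℂ) = P.eval (Fintype.card F : ℂ) := by
    intro p hp F _ _ _
    rw [hP, ← Rat.cast_natCast (A.markedCount m S F), hN p hp F, Rat.cast_sum]
    refine Finset.sum_congr rfl fun lam _ => ?_
    rw [Rat.cast_div, Rat.cast_natCast, ← Rat.cast_natCast (Fintype.card F)]
    congr 1
    exact (Polynomial.aeval_algebraMap_apply ℂ (Fintype.card F : ℚ) _).symm
  refine ⟨⟨N, fun p _ hp => hN p hp⟩, P, fun Q => ⟨?_, ?_⟩, hP⟩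
  · rintro ⟨N', hN'⟩
    refine Polynomial.eq_of_infinite_eval_eq _ _ ?_
    have hinf : {p : ℕ | p.Prime ∧ max N N' < p}.Infinite := by
      refine Set.infinite_of_not_bddAbove fun ⟨b, hb⟩ => ?_
      obtain ⟨p, hp, hpp⟩ := Nat.exists_infinite_primes (max b (max N N') + 1)
      have := hb ⟨hpp, show max N N' < p by omega⟩
      omega
    refine (hinf.image Nat.cast_injective.injOn).mono ?_
    rintro _ ⟨p, ⟨hp, hlt⟩, rfl⟩
    have := Fact.mk hp
    -- The prime fields alone force `Q = P`; `ULift` places $\mathbb Z/p$ in the universe of the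
    -- statement.
    have h1 := hN' p hp (by omega) (ULift.{u} (ZMod p))
    rw [hPN p (by omega)] at h1
    rw [Fintype.card_ulift, ZMod.card] at h1
    exact h1.symm
  · rintro rfl
    exact ⟨N, fun p _ hp => hPN p hp⟩
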